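/- Let $\mathcal A$ be a unital $C^*$-algebra and let $\mathcal F\subseteq\mathcal A$ be an ideal of finite type elements, that is, a (not necessarily closed) subalgebra such that (i) $\mathcal F$ is a selfadjoint two-sided ideal of $\mathcal A$; (ii) $\mathcal F$ has an approximate unit consisting of projections; (iii) for all projections $p,q\in\mathcal F$ there is $v\in\mathcal A$ with $vv^*=q$ such that $v^*v+p$ is a projection. Regard $\mathcal A$ as a right Hilbert module over itself with inner product $\langle x,y\rangle=x^*y$, let $B(\mathcal A)$ be the algebra of bounded $\mathcal A$-linear operators on $\mathcal A$, and identify $a\in\mathcal A$ with the operator $x\mapsto ax$; this identifies $\mathcal A$ with $B(\mathcal A)$ isometrically. For closed submodules write $\mathcal A=M\,\tilde\oplus\,N$ if $M+N=\mathcal A$ and $M\cap N=\{0\}$; in this case the orthogonal projections $P_M$ and $P_N$ onto $M$ and $N$ exist in $B(\mathcal A)$. Write $M\cong N$ if there is a bounded $\mathcal A$-linear bijection $M\to N$ with bounded inverse, and $M\preceq N$ if $M$ is isomorphic in this sense to a closed submodule of $N$. A decomposition for $F\in B(\mathcal A)$ consists of closed submodules with $\mathcal A=M_1\tilde\oplus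 N_1=M_2\tilde\oplus N_2$, $F(M_1)\subseteq M_2$ and $F(N_1)\subseteq N_2$, such that $F|_{M_1}:M_1\to M_2$ is an isomorphism. Define the following subsets of $B(\mathcal A)$: - $\mathcal{MK}\Phi_+(\mathcal A)$, $\mathcal{MK}\Phi_-(\mathcal A)$, $\mathcal{MK}\Phi(\mathcal A)$: the operators that have a decomposition with $P_{N_1}\in\mathcal F$; with $P_{N_2}\in\mathcal F$; with both $P_{N_1},P_{N_2}\in\mathcal F$, respectively; - $\mathcal{MK}{\Phi_+^-}'(\mathcal A)$: those that have a decomposition with $P_{N_1}\in\mathcal F$ and $N_1\preceq N_2$; - $\mathcal{MK}{\Phi_-^+}'(\mathcal A)$: those that have a decomposition with $P_{N_2}\in\mathcal F$ and $N_2\preceq N_1$; - $\mathcal{MK}\Phi_0(\mathcal A)$: those that have a decomposition with $P_{N_1},P_{N_2}\in\mathcal F$ and $N_1\cong N_2$. Then the sets $$\mathcal{MK}\Phi_+(\mathcal A)\setminus\mathcal{MK}{\Phi_+^-}'(\mathcal A),\qquad \mathcal{MK}\Phi_-(\mathcal A)\setminus\mathcal{MK}{\Phi_-^+}'(\mathcal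 A),\qquad \mathcal{MK}\Phi(\mathcal A)\setminus\mathcal{MK}\Phi_0(\mathcal A)$$ are open in the norm topology of $B(\mathcal A)$. -/

import Mathlib

open scoped Topology
open MulOpposite

namespace FiniteType

/-- A unital C⋆-algebra `A` is regarded as a right module over itself, that is, as a module over
`Aᵐᵒᵖ`, with the `A`-valued inner product `⟨x, y⟩ = star x * y`.
`EndMod A` is `B(A)`, the bounded `A`-linear operators on this Hilbert module. -/
abbrev EndMod (A : Type*) [CStarAlgebra A] : Type _ := A →L[Aᵐᵒᵖ] A

/-- The operator-norm topology of `B(A)`: the one induced by the inclusion of the bounded `A`-linear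
operators into the normed space of all bounded `ℂ`-linear operators on `A`. -/
noncomputable abbrev normTopology (A : Type*) [CStarAlgebra A] : TopologicalSpace (EndMod A) :=
  TopologicalSpace.induced (fun F : EndMod A => (F.restrictScalars ℂ : A →L[ℂ] A)) inferInstance

/-- The left multiplier `x ↦ a * x`; `a ↦ leftMul a` identifies `A` with `B(A)`. -/
noncomputable def leftMul {A : Type*} [CStarAlgebra A] (a : A) : EndMod A where
  toFun x := a * x
  map_add' := mul_add a
  map_smul' c x := by simp [MulOpposite.smul_eq_mul_unop, mul_assoc]
  cont := continuous_const.mul continuous_id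

/-- `𝓕` is an ideal of finite type elements of `A`. It need not be norm closed. -/
structure IsFiniteTypeIdeal {A : Type*} [CStarAlgebra A]
    (𝓕 : NonUnitalStarSubalgebra ℂ A) : Prop where
  mul_mem_left : ∀ a : A, ∀ b ∈ 𝓕, a * b ∈ 𝓕
  mul_mem_right : ∀ a : A, ∀ b ∈ 𝓕, b * a ∈ 𝓕
  /-- `𝓕` has an approximate unit consisting of projections (a net, given by its filter). -/
  exists_approximateUnit : ∃ l : Filter 𝓕, l.IsApproximateUnit ∧ ∀ᶠ p in l, IsStarProjection p
  exists_orthogonal_copy : ∀ p ∈ 𝓕, ∀ q ∈ 𝓕, IsStarProjection p → IsStarProjection q →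
    ∃ v : A, v * star v = q ∧ IsStarProjection (star v * v + p)

section Decompositions

variable {A : Type*} [CStarAlgebra A]

/-- `P ∈ B(A)` is the orthogonal projection of the Hilbert module `A` onto the submodule `N`:
an idempotent with image `N`, selfadjoint for the inner product `⟨x, y⟩ = star x * y`. -/
structure IsOrthogonalProjectionOnto (P : EndMod A) (N : Submodule Aᵐᵒᵖ A) : Prop where
  idempotent : ∀ x, P (P x) = P x
  selfAdjoint : ∀ x y, star (P x) * y = star x * P y
  range_eq : Set.range P = (N : Set A)

/-- `P_N ∈ 𝓕`, where `𝓕 ⊆ A` is identified with its image in `B(A)` under left multiplication. -/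
def ProjMem (𝓕 : NonUnitalStarSubalgebra ℂ A) (N : Submodule Aᵐᵒᵖ A) : Prop :=
  ∃ p ∈ 𝓕, IsOrthogonalProjectionOnto (leftMul p) N

/-- `A = M ⊕̃ N`: a (not necessarily orthogonal) direct sum of closed submodules. -/
structure IsDirectSum (M N : Submodule Aᵐᵒᵖ A) : Prop where
  isClosed_left : IsClosed (M : Set A)
  isClosed_right : IsClosed (N : Set A)
  isCompl : IsCompl M N

/-- With respect to `A = M₁ ⊕̃ N₁ ⟶ M₂ ⊕̃ N₂ = A` the operator `F` has a diagonal matrix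
`diag(F₁, F₄)` in which `F₁ : M₁ → M₂` is an isomorphism. -/
structure IsDecomposition (F : EndMod A) (M₁ N₁ M₂ N₂ : Submodule Aᵐᵒᵖ A) : Prop where
  source : IsDirectSum M₁ N₁
  target : IsDirectSum M₂ N₂
  iso : ∃ e : M₁ ≃L[Aᵐᵒᵖ] M₂, ∀ x : M₁, (e x : A) = F x
  mapsTo : ∀ x ∈ N₁, F x ∈ N₂

/-- `M ≅ N`: isomorphism of Hilbert modules (bounded, `A`-linear, with bounded inverse). -/
def ModIso (M N : Submodule Aᵐᵒᵖ A) : Prop := Nonempty (M ≃L[Aᵐᵒᵖ] N)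

/-- `M ≼ N`: `M` is isomorphic to a closed submodule of `N`. -/
def ModSub (M N : Submodule Aᵐᵒᵖ A) : Prop :=
  ∃ N' : Submodule Aᵐᵒᵖ A, N' ≤ N ∧ IsClosed (N' : Set A) ∧ ModIso M N'

/-- Upper semi-Fredholm operators. -/
def MKPhiPlus (𝓕 : NonUnitalStarSubalgebra ℂ A) : Set (EndMod A) :=
  {F | ∃ M₁ N₁ M₂ N₂, IsDecomposition F M₁ N₁ M₂ N₂ ∧ ProjMem 𝓕 N₁}

/-- Lower semi-Fredholm operators. -/
def MKPhiMinus (𝓕 : NonUnitalStarSubalgebra ℂ A) : Set (EndMod A) :=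
  {F | ∃ M₁ N₁ M₂ N₂, IsDecomposition F M₁ N₁ M₂ N₂ ∧ ProjMem 𝓕 N₂}

/-- Fredholm operators. -/
def MKPhi (𝓕 : NonUnitalStarSubalgebra ℂ A) : Set (EndMod A) :=
  {F | ∃ M₁ N₁ M₂ N₂, IsDecomposition F M₁ N₁ M₂ N₂ ∧ ProjMem 𝓕 N₁ ∧ ProjMem 𝓕 N₂}

/-- Upper semi-Weyl operators. -/
def MKPhiPlusMinus (𝓕 : NonUnitalStarSubalgebra ℂ A) : Set (EndMod A) :=
  {F | ∃ M₁ N₁ M₂ N₂, IsDecomposition F M₁ N₁ M₂ N₂ ∧ ProjMem 𝓕 N₁ ∧ ModSub N₁ N₂}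

/-- Lower semi-Weyl operators. -/
def MKPhiMinusPlus (𝓕 : NonUnitalStarSubalgebra ℂ A) : Set (EndMod A) :=
  {F | ∃ M₁ N₁ M₂ N₂, IsDecomposition F M₁ N₁ M₂ N₂ ∧ ProjMem 𝓕 N₂ ∧ ModSub N₂ N₁}

/-- Weyl operators. -/
def MKPhiZero (𝓕 : NonUnitalStarSubalgebra ℂ A) : Set (EndMod A) :=
  {F | ∃ M₁ N₁ M₂ N₂, IsDecomposition F M₁ N₁ M₂ N₂ ∧ ProjMem 𝓕 N₁ ∧ ProjMem 𝓕 N₂ ∧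
    ModIso N₁ N₂}

end Decompositions

end FiniteType

/-! An operator `F` is left multiplication by `f = F 1`, and its decompositions correspond to outer
inverses `g` of `f` (`g f g = g`), with `N₁ = (1 - gf)A` and `N₂ = (1 - fg)A`. The six classes
thereby become conditions on the two defect idempotents `1 - gf` and `1 - fg`: membership in `𝓕`,
and algebraic equivalence or subordination (`mem_iff_of_decomposition`).

For small `d`, `(1 + gd)⁻¹ g` is an outer inverse of `f + d` with equivalent defects
(`IsOuterInverse.perturb`), so the Fredholm conditions persist. It remains to see that a Weyl-type
outer inverse `h` of `f + d` forces one for `f`. The approximate unit gives a projection `p` in `𝓕`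
such that `r = 1 - p` nearly annihilates both source defects. Then `g` and `h` compress to outer
inverses `k` and `l` with common range `rA` (`IsOuterInverse.exists_compression`), so their defects
are equivalent (`IsOuterInverse.idemEquiv_perturb`). Passing from `h` to `l` adds equivalent
orthogonal summands to both defects (`IsOuterInverse.exists_refinement`), which preserves the Weyl
comparison. Since `‖k‖ ≤ 2‖g‖`, the admissible size of `d` does not depend on `h`. The lower case
follows by taking adjoints. -/

namespace FiniteType

/-! ### Idempotents and outer inverses in a ring -/

section Ring

variable {R : Type*} [Ring R]

/-- `s` and `t` implement an algebraic Murray–von Neumann equivalence of the idempotents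
`p = s * t` and `q = t * s`. -/
def IdemEquiv (p q : R) : Prop :=
  ∃ s t : R, s * t = p ∧ t * s = q ∧ p * s = s ∧ q * t = t

/-- Algebraic Murray–von Neumann subordination of idempotents. -/
def IdemSub (p q : R) : Prop := ∃ s t : R, s * q * t = p

lemma IdemEquiv.symm {p q : R} (h : IdemEquiv p q) : IdemEquiv q p := by
  obtain ⟨s, t, h₁, h₂, h₃, h₄⟩ := h
  exact ⟨t, s, h₂, h₁, h₄, h₃⟩

lemma IdemEquiv.trans {p q r : R} (h : IdemEquiv p q) (h' : IdemEquiv q r) : IdemEquiv p r := by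
  obtain ⟨s, t, h₁, h₂, h₃, h₄⟩ := h
  obtain ⟨s', t', h₁', h₂', h₃', h₄'⟩ := h'
  refine ⟨s * s', t' * t, ?_, ?_, ?_, ?_⟩
  · calc s * s' * (t' * t) = s * ((s' * t') * t) := by noncomm_ring
      _ = p := by rw [h₁', h₄, h₁]
  · calc t' * t * (s * s') = t' * ((t * s) * s') := by noncomm_ring
      _ = r := by rw [h₂, h₃', h₂']
  · rw [← mul_assoc, h₃]
  · rw [← mul_assoc, h₄']

lemma IdemEquiv.idemSub {p q : R} (h : IdemEquiv p q) : IdemSub p q := by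
  obtain ⟨s, t, h₁, h₂, h₃, h₄⟩ := h
  exact ⟨s, t, by rw [mul_assoc, h₄, h₁]⟩

lemma IdemSub.trans {p q r : R} (h : IdemSub p q) (h' : IdemSub q r) : IdemSub p r := by
  obtain ⟨s, t, rfl⟩ := h
  obtain ⟨s', t', rfl⟩ := h'
  exact ⟨s * s', t' * t, by noncomm_ring⟩

/-- The hypotheses say that `a` and `b` are idempotents with the same range; the primed version is
the case of equal kernels. Passing to `1 - a` and `1 - b` exchanges the two cases. -/
lemma idemEquiv_of_mul_eq {a b : R} (h : a * b = b) (h' : b * a = a) : IdemEquiv a b := by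
  refine ⟨b, a, h', h, h, h'⟩

lemma idemEquiv_of_mul_eq' {a b : R} (h : a * b = a) (h' : b * a = b) : IdemEquiv a b := by
  refine ⟨a, b, h, h', ?_, ?_⟩
  · calc a * a = a * (b * a) := by rw [← mul_assoc, h]
      _ = a := by rw [h', h]
  · calc b * b = b * (a * b) := by rw [← mul_assoc, h']
      _ = b := by rw [h, h']

lemma idemEquiv_one_sub {a b : R} (h : a * b = a) (h' : b * a = b) :
    IdemEquiv (1 - a) (1 - b) :=
  idemEquiv_of_mul_eq (by simp [mul_sub, sub_mul, h]) (by simp [mul_sub, sub_mul, h'])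

lemma idemEquiv_one_sub' {a b : R} (hab : a * b = b) (hba : b * a = a) :
    IdemEquiv (1 - a) (1 - b) :=
  idemEquiv_of_mul_eq' (by simp [mul_sub, sub_mul, hab]) (by simp [mul_sub, sub_mul, hba])

/-- `g` is an outer inverse of `f`. -/
def IsOuterInverse (f g : R) : Prop := g * f * g = g

namespace IsOuterInverse

variable {f g h k : R}

lemma mul_assoc_eq (H : IsOuterInverse f g) : g * (f * g) = g := by rw [← mul_assoc]; exact H

lemma isIdempotentElem_left (H : IsOuterInverse f g) : IsIdempotentElem (g * f) := by
  unfold IsIdempotentElem; rw [← mul_assoc, H]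

lemma isIdempotentElem_right (H : IsOuterInverse f g) : IsIdempotentElem (f * g) := by
  unfold IsIdempotentElem; rw [mul_assoc, H.mul_assoc_eq]

/-- Outer inverses with the same range have equivalent defects. -/
lemma idemEquiv_of_range (h₁ : g * f * h = h) (h₂ : h * f * g = g) :
    IdemEquiv (1 - g * f) (1 - h * f) ∧ IdemEquiv (1 - f * g) (1 - f * h) := by
  refine ⟨idemEquiv_one_sub' ?_ ?_, idemEquiv_one_sub' ?_ ?_⟩
  · rw [← mul_assoc, h₁]
  · rw [← mul_assoc, h₂]
  · rw [mul_assoc, ← mul_assoc g, h₁]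
  · rw [mul_assoc, ← mul_assoc h, h₂]

/-- Outer inverses with the same kernel have equivalent defects. -/
lemma idemEquiv_of_ker (h₁ : g * f * h = g) (h₂ : h * f * g = h) :
    IdemEquiv (1 - g * f) (1 - h * f) ∧ IdemEquiv (1 - f * g) (1 - f * h) := by
  refine ⟨idemEquiv_one_sub ?_ ?_, idemEquiv_one_sub ?_ ?_⟩
  · rw [← mul_assoc, h₁]
  · rw [← mul_assoc, h₂]
  · rw [mul_assoc, ← mul_assoc g, h₁]
  · rw [mul_assoc, ← mul_assoc h, h₂]

/-- A small perturbation of `f` has an outer inverse with equivalent defects. -/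
lemma perturb (H : IsOuterInverse f g) (d : R) (u : Rˣ) (hu : (u : R) = 1 + g * d) :
    IsOuterInverse (f + d) (↑u⁻¹ * g) ∧
    IdemEquiv (1 - g * f) (1 - ↑u⁻¹ * g * (f + d)) ∧
    IdemEquiv (1 - f * g) (1 - (f + d) * (↑u⁻¹ * g)) := by
  have H' := H.mul_assoc_eq
  have a1 : (1 - g * f) * g = 0 := by rw [sub_mul, H]; simp
  have a2 : (1 - g * f) * u = 1 - g * f := by
    rw [hu, mul_add, mul_one, ← mul_assoc, a1]; simp
  have a3 : (1 - g * f) * ↑u⁻¹ = 1 - g * f := by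
    rw [Units.mul_inv_eq_iff_eq_mul, a2]
  -- `g (f + d)` differs from `u` only by the old source defect, so the new source defect is exactly
  -- `u⁻¹ (1 - g f)`.
  have a4 : ↑u⁻¹ * g * (f + d) = 1 - ↑u⁻¹ * (1 - g * f) := by
    have : g * (f + d) = u - (1 - g * f) := by rw [hu]; noncomm_ring
    rw [mul_assoc, this, mul_sub, Units.inv_mul]
  have idem : (1 - g * f) * (1 - g * f) = 1 - g * f := by
    rw [mul_sub, ← mul_assoc, a1]; simp
  have out : ↑u⁻¹ * g * (f + d) * (↑u⁻¹ * g) = ↑u⁻¹ * g := by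
    rw [a4, sub_mul, mul_assoc, ← mul_assoc (1 - g * f), a3, a1]; simp
  refine ⟨out, ?_, ?_⟩
  · rw [a4, sub_sub_cancel]
    refine ⟨1 - g * f, ↑u⁻¹ * (1 - g * f), ?_, ?_, idem, ?_⟩
    · rw [← mul_assoc, a3, idem]
    · rw [mul_assoc, idem]
    · rw [mul_assoc, ← mul_assoc _ (↑u⁻¹ : R), a3, idem]
  -- `f g` and `(f + d) u⁻¹ g` both have the kernel of `g`, so the target defects have the same
  -- range.
  · have key : g * ((f + d) * (↑u⁻¹ * g)) = g := by
      have : g * (f + d) * ↑u⁻¹ = 1 - (1 - g * f) * ↑u⁻¹ := by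
        have : g * (f + d) = u - (1 - g * f) := by rw [hu]; noncomm_ring
        rw [this, sub_mul, Units.mul_inv]
      rw [← mul_assoc, ← mul_assoc, this, a3]
      rw [sub_sub_cancel, H]
    have hk : ↑u⁻¹ * g * (f * g) = ↑u⁻¹ * g := by rw [mul_assoc, H']
    apply idemEquiv_one_sub
    · rw [mul_assoc, key]
    · rw [mul_assoc, hk]

/-- If `k` factors through the outer inverse `h`, passing from `h` to `k` adds equivalent summands
to both defects. -/
lemma exists_refinement (hh : IsOuterInverse f h) (hk : IsOuterInverse f k)
    (hkh : k * f * h = k) :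
    ∃ x₁ x₂ a b : R, IdemEquiv (1 - k * f) ((1 - h * f) + x₁) ∧
      IdemEquiv (1 - f * k) ((1 - f * h) + x₂) ∧
      a * b = x₁ ∧ b * a = x₂ ∧ x₁ * a = a ∧ x₂ * b = b ∧
      (1 - h * f) * x₁ = 0 ∧ x₁ * (1 - h * f) = 0 ∧
      (1 - f * h) * x₂ = 0 ∧ x₂ * (1 - f * h) = 0 := by
  have h1 := hh.mul_assoc_eq
  have h1' (z : R) : h * (f * (h * z)) = h * z := by
    rw [← mul_assoc, ← mul_assoc, hh]
  have k1 := hk.mul_assoc_eq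
  have k1' (z : R) : k * (f * (k * z)) = k * z := by
    rw [← mul_assoc, ← mul_assoc, hk]
  have kh : k * (f * h) = k := by rw [← mul_assoc, hkh]
  have kh' (z : R) : k * (f * (h * z)) = k * z := by
    rw [← mul_assoc, ← mul_assoc, hkh]
  -- `h f k` has the kernel of `k` and its range lies in that of `h`. After this replacement the
  -- defects grow by genuine orthogonal summands, which `f` and `h` carry into each other.
  obtain ⟨e₁, e₂⟩ := idemEquiv_of_ker (f := f) (g := k) (h := h * f * k)
    (by simp [mul_assoc, kh', k1]) (by simp [mul_assoc, k1])
  refine ⟨h * f - h * f * k * f, f * h - f * (h * f * k), (h * f - h * f * k * f) * h,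
    f * (h * f - h * f * k * f), ?_, ?_, ?_, ?_, ?_, ?_, ?_, ?_, ?_, ?_⟩
  · rwa [sub_add_sub_cancel]
  · rwa [sub_add_sub_cancel]
  all_goals simp [mul_sub, sub_mul, mul_assoc, h1, h1', k1, k1', kh, kh']

end IsOuterInverse

/-- Adding equivalent orthogonal summands preserves subordination. -/
lemma IdemSub.add {p q x y a b : R} (hq : IsIdempotentElem q)
    (hpq : IdemSub p q) (h₁ : a * b = x) (h₂ : b * a = y) (h₃ : x * a = a) (h₄ : y * b = b)
    (h₅ : q * y = 0) (h₆ : y * q = 0) : IdemSub (p + x) (q + y) := by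
  obtain ⟨s, t, rfl⟩ := hpq
  have hay : a * y = a := by rw [← h₂, ← mul_assoc, h₁, h₃]
  have hyy : y * y = y := by nth_rw 2 [← h₂]; rw [← mul_assoc, h₄, h₂]
  have haq : a * q = 0 := by rw [← hay, mul_assoc, h₆, mul_zero]
  have hqb : q * b = 0 := by rw [← h₄, ← mul_assoc, h₅, zero_mul]
  have hq' (z : R) : q * (q * z) = q * z := by rw [← mul_assoc, hq]
  have h₅' (z : R) : q * (y * z) = 0 := by rw [← mul_assoc, h₅, zero_mul]
  have h₆' (z : R) : y * (q * z) = 0 := by rw [← mul_assoc, h₆, zero_mul]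
  have haq' (z : R) : a * (q * z) = 0 := by rw [← mul_assoc, haq, zero_mul]
  -- `s` and `t` are not normalised; cutting them by `q` kills the cross terms.
  refine ⟨s * q + a, q * t + b, ?_⟩
  simp [mul_add, add_mul, mul_assoc, hq.eq, hq', h₄, h₅, h₆', haq', hqb, h₁]

/-- Adding equivalent orthogonal summands preserves equivalence. -/
lemma IdemEquiv.add {p q x y a b : R}
    (hpq : IdemEquiv p q) (h₁ : a * b = x) (h₂ : b * a = y) (h₃ : x * a = a) (h₄ : y * b = b)
    (h₅ : p * x = 0) (h₆ : x * p = 0)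
    (h₇ : q * y = 0) (h₈ : y * q = 0) : IdemEquiv (p + x) (q + y) := by
  obtain ⟨s, t, hp, hq, hs, ht⟩ := hpq
  have hay : a * y = a := by rw [← h₂, ← mul_assoc, h₁, h₃]
  have hbx : b * x = b := by rw [← h₁, ← mul_assoc, h₂, h₄]
  have hsq : s * q = s := by rw [← hq, ← mul_assoc, hp, hs]
  have htp : t * p = t := by rw [← hp, ← mul_assoc, hq, ht]
  have e₁ : s * b = 0 := by rw [← hsq, ← h₄, mul_assoc, ← mul_assoc q, h₇]; simp
  have e₂ : a * t = 0 := by rw [← hay, ← ht, mul_assoc, ← mul_assoc y, h₈]; simp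
  have e₃ : t * a = 0 := by rw [← htp, ← h₃, mul_assoc, ← mul_assoc p, h₅]; simp
  have e₄ : b * s = 0 := by rw [← hbx, ← hs, mul_assoc, ← mul_assoc x, h₆]; simp
  have e₅ : p * a = 0 := by rw [← h₃, ← mul_assoc, h₅, zero_mul]
  have e₆ : x * s = 0 := by rw [← hs, ← mul_assoc, h₆, zero_mul]
  have e₇ : q * b = 0 := by rw [← h₄, ← mul_assoc, h₇, zero_mul]
  have e₈ : y * t = 0 := by rw [← ht, ← mul_assoc, h₈, zero_mul]
  refine ⟨s + a, t + b, ?_, ?_, ?_, ?_⟩ <;> simp [mul_add, add_mul, *]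

/-- If `k` is obtained from the outer inverse `h` by shrinking, the defects of `k` compare at least
as well as those of `h`. -/
lemma IsOuterInverse.idemSub_of_mul_eq {f h k : R} (hh : IsOuterInverse f h)
    (hk : IsOuterInverse f k) (hkh : k * f * h = k) (H : IdemSub (1 - h * f) (1 - f * h)) :
    IdemSub (1 - k * f) (1 - f * k) := by
  obtain ⟨x₁, x₂, a, b, E₁, E₂, h₁, h₂, h₃, h₄, -, -, h₅, h₆⟩ := hh.exists_refinement hk hkh
  exact E₁.idemSub.trans ((H.add
    hh.isIdempotentElem_right.one_sub h₁ h₂ h₃ h₄ h₅ h₆).trans E₂.symm.idemSub)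

lemma IsOuterInverse.idemEquiv_of_mul_eq {f h k : R} (hh : IsOuterInverse f h)
    (hk : IsOuterInverse f k) (hkh : k * f * h = k) (H : IdemEquiv (1 - h * f) (1 - f * h)) :
    IdemEquiv (1 - k * f) (1 - f * k) := by
  obtain ⟨x₁, x₂, a, b, E₁, E₂, h₁, h₂, h₃, h₄, h₅, h₆, h₇, h₈⟩ := hh.exists_refinement hk hkh
  exact E₁.trans ((H.add h₁ h₂ h₃ h₄ h₅ h₆ h₇ h₈).trans E₂.symm)

/-- Two outer inverses, one of `f` and one of a perturbation `f + d`, both normalised to have the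
range of the idempotent `r`, have equivalent defects. -/
lemma IsOuterInverse.idemEquiv_perturb {f d k l r : R} (hk : IsOuterInverse f k)
    (hkr : k * f * r = r) (hrk : r * k = k) (hlr : l * (f + d) * r = r) (hrl : r * l = l)
    (hu : IsUnit (1 + k * d)) :
    IdemEquiv (1 - k * f) (1 - l * (f + d)) ∧ IdemEquiv (1 - f * k) (1 - (f + d) * l) := by
  obtain ⟨u, hu⟩ := hu
  obtain ⟨-, E₁, E₂⟩ := hk.perturb d u hu
  set m := ↑u⁻¹ * k with hm
  -- `u - 1 = k d` has range inside that of `r`, so `u⁻¹` does not move the range of `k`; `m` and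
  -- `l` are then outer inverses of `f + d` with equal range.
  have hur : (1 - r) * (↑u⁻¹ : R) = 1 - r := by
    rw [Units.mul_inv_eq_iff_eq_mul, hu, mul_add, ← mul_assoc, sub_mul 1 r k, hrk]; simp
  have hrm : r * m = m := by
    have : (1 - r) * m = 0 := by rw [hm, ← mul_assoc, hur, sub_mul, hrk]; simp
    rw [sub_mul, one_mul, sub_eq_zero] at this
    exact this.symm
  have hmr : m * (f + d) * r = r := by
    have : k * (f + d) * r = u * r := by
      rw [hu, mul_add, add_mul, hkr]; noncomm_ring
    rw [hm, mul_assoc, mul_assoc, ← mul_assoc k, this, ← mul_assoc, Units.inv_mul, one_mul]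
  obtain ⟨E₃, E₄⟩ := idemEquiv_of_range (f := f + d) (g := m) (h := l)
    (by rw [← hrl, ← mul_assoc, hmr]) (by rw [← hrm, ← mul_assoc, hlr])
  exact ⟨E₁.trans E₃, E₂.trans E₄⟩

end Ring


/-! ### Compression of outer inverses by projections -/

section Analysis

variable {A : Type*} [CStarAlgebra A]

/-- Cutting an outer inverse down to the range of a projection `r` that almost annihilates its
source defect. -/
lemma IsOuterInverse.exists_compression {f g r : A} (hg : IsOuterInverse f g)
    (hr : IsStarProjection r) (hn : ‖(1 - g * f) * r‖ < 1 / 2) :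
    ∃ k, IsOuterInverse f k ∧ k * f * r = r ∧ r * k = k ∧ k * f * g = k ∧ ‖k‖ ≤ 2 * ‖g‖ := by
  have hrr : r * r = r := hr.isIdempotentElem
  have hr1 : ‖r‖ ≤ 1 := hr.norm_le
  set x := r * ((1 - g * f) * r) with hx
  have hx2 : ‖x‖ ≤ 1 / 2 := by
    calc ‖x‖ ≤ ‖r‖ * ‖(1 - g * f) * r‖ := norm_mul_le _ _
      _ ≤ 1 * (1 / 2) := by gcongr
      _ = 1 / 2 := one_mul _
  -- On the range of `r`, the compression `r g f r` acts as the unit `w`, so `w⁻¹ r g` is the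
  -- corrected outer inverse.
  obtain ⟨w, hw⟩ : ∃ w : Aˣ, (w : A) = 1 - x :=
    ⟨Units.oneSub x (by linarith), rfl⟩
  have hrx : r * x = x := by rw [hx, ← mul_assoc, hrr]
  have hxr : x * r = x := by rw [hx, mul_assoc, mul_assoc, hrr]
  have hwr : (↑w⁻¹ : A) * r = r * ↑w⁻¹ := by
    have : Commute (w : A) r := by
      show (w : A) * r = r * w
      rw [hw, sub_mul, mul_sub, hxr, hrx]; simp
    exact this.units_inv_left
  have hrk : r * (↑w⁻¹ * (r * g)) = ↑w⁻¹ * (r * g) := by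
    rw [← mul_assoc, ← hwr, mul_assoc, ← mul_assoc r r, hrr]
  have hkr : ↑w⁻¹ * (r * g) * f * r = r := by
    have : r * g * f * r = w * r := by
      rw [hw, sub_mul, hxr, hx, sub_mul, mul_sub, one_mul, hrr]; noncomm_ring
    rw [mul_assoc, mul_assoc, ← mul_assoc (r * g), this, ← mul_assoc, Units.inv_mul, one_mul]
  refine ⟨↑w⁻¹ * (r * g), ?_, hkr, hrk, ?_, ?_⟩
  · unfold IsOuterInverse
    nth_rw 2 [← hrk]
    rw [← mul_assoc, hkr, hrk]
  · rw [mul_assoc, mul_assoc, mul_assoc, hg.mul_assoc_eq]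
  · set k := ↑w⁻¹ * (r * g) with hk
    -- With `‖x‖ ≤ 1/2` this self-referential identity bounds `‖k‖` independently of `r`.
    have h1 : k = r * g + x * k := by
      have : (w : A) * k = r * g := by rw [hk, ← mul_assoc, Units.mul_inv, one_mul]
      rw [← this, hw]; noncomm_ring
    have h2 : ‖k‖ ≤ 1 * ‖g‖ + 1 / 2 * ‖k‖ := by
      calc ‖k‖ = ‖r * g + x * k‖ := by rw [← h1]
        _ ≤ ‖r * g‖ + ‖x * k‖ := norm_add_le _ _
        _ ≤ ‖r‖ * ‖g‖ + ‖x‖ * ‖k‖ := add_le_add (norm_mul_le _ _) (norm_mul_le _ _)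
        _ ≤ 1 * ‖g‖ + 1 / 2 * ‖k‖ := by gcongr
    linarith

lemma isUnit_one_add_mul {k d : A} {C : ℝ} (hk : ‖k‖ ≤ C) (hd : C * ‖d‖ < 1) :
    IsUnit (1 + k * d) := by
  have : ‖-(k * d)‖ < 1 := by
    rw [norm_neg]
    exact ((norm_mul_le _ _).trans (by gcongr)).trans_lt hd
  have h := (Units.oneSub _ this).isUnit
  rwa [Units.val_oneSub, sub_neg_eq_add] at h

/-! ### Finite type defects and openness of the algebraic classes -/

variable {𝓕 : NonUnitalStarSubalgebra ℂ A}

lemma IsFiniteTypeIdeal.mem_of_idemEquiv (h𝓕 : IsFiniteTypeIdeal 𝓕) {p q : A}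
    (h : IdemEquiv p q) (hp : p ∈ 𝓕) : q ∈ 𝓕 := by
  obtain ⟨s, t, -, rfl, hs, -⟩ := h
  rw [← hs, ← mul_assoc]
  exact h𝓕.mul_mem_right _ _ (h𝓕.mul_mem_left _ _ hp)

/-- One projection must serve both elements, because the two compressions are to share a range. -/
lemma IsFiniteTypeIdeal.exists_projection (h𝓕 : IsFiniteTypeIdeal 𝓕) {n m : A}
    (hn : n ∈ 𝓕) (hm : m ∈ 𝓕) :
    ∃ p ∈ 𝓕, IsStarProjection p ∧ ‖n * (1 - p)‖ < 1 / 2 ∧ ‖m * (1 - p)‖ < 1 / 2 := by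
  obtain ⟨l, hl, hp⟩ := h𝓕.exists_approximateUnit
  have := hl.neBot
  have key : ∀ n : 𝓕, ∀ᶠ p : 𝓕 in l, ‖(n : A) * (1 - p)‖ < 1 / 2 := by
    intro n
    have := hl.tendsto_mul_left n
    rw [Metric.tendsto_nhds] at this
    filter_upwards [this (1 / 2) (by norm_num)] with p hp
    rw [dist_comm, dist_eq_norm] at hp
    rw [mul_sub, mul_one]
    exact hp
  obtain ⟨p, h₁, h₂, h₃⟩ := (hp.and ((key ⟨n, hn⟩).and (key ⟨m, hm⟩))).exists
  refine ⟨p, p.2, ⟨?_, ?_⟩, h₂, h₃⟩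
  · exact congrArg Subtype.val h₁.isIdempotentElem
  · exact congrArg Subtype.val h₁.isSelfAdjoint

/-- An outer inverse of `f` and one of a sufficiently near `f + d` have refinements with equivalent
defects. -/
lemma exists_common_refinement (h𝓕 : IsFiniteTypeIdeal 𝓕) {f g d h : A}
    (hg : IsOuterInverse f g) (hgm : 1 - g * f ∈ 𝓕) (hd : 2 * ‖g‖ * ‖d‖ < 1)
    (hh : IsOuterInverse (f + d) h) (hhm : 1 - h * (f + d) ∈ 𝓕) :
    ∃ k l, IsOuterInverse f k ∧ 1 - k * f ∈ 𝓕 ∧ IsOuterInverse (f + d) l ∧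
      l * (f + d) * h = l ∧ IdemEquiv (1 - k * f) (1 - l * (f + d)) ∧
      IdemEquiv (1 - f * k) (1 - (f + d) * l) := by
  obtain ⟨p, hp, hproj, h₁, h₂⟩ := h𝓕.exists_projection hgm hhm
  obtain ⟨k, hk, hkr, hrk, -, hnorm⟩ := hg.exists_compression hproj.one_sub h₁
  obtain ⟨l, hl, hlr, hrl, hlh, -⟩ := hh.exists_compression hproj.one_sub h₂
  refine ⟨k, l, hk, ?_, hl, hlh,
    hk.idemEquiv_perturb hkr hrk hlr hrl (isUnit_one_add_mul hnorm hd)⟩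
  -- `k f` fixes `1 - p`, so the source defect factors through `p`.
  have : 1 - k * f = (1 - k * f) * p := by
    rw [mul_sub, mul_one, sub_eq_sub_iff_add_eq_add] at hkr
    rw [sub_mul, one_mul, sub_eq_sub_iff_add_eq_add, ← hkr, add_comm]
  rw [this]
  exact h𝓕.mul_mem_left _ _ hp

variable (𝓕)

/-- Elements with an outer inverse whose source defect is of finite type. -/
def LeftFredholm : Set A := {f | ∃ g, IsOuterInverse f g ∧ 1 - g * f ∈ 𝓕}

/-- Elements with an outer inverse whose target defect is of finite type. -/
def RightFredholm : Set A := {f | ∃ g, IsOuterInverse f g ∧ 1 - f * g ∈ 𝓕}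

/-- Elements with an outer inverse whose defects are of finite type. -/
def Fredholm : Set A := {f | ∃ g, IsOuterInverse f g ∧ 1 - g * f ∈ 𝓕 ∧ 1 - f * g ∈ 𝓕}

/-- Elements with an outer inverse whose source defect is of finite type and subordinate to its
target defect. -/
def LeftWeyl : Set A :=
  {f | ∃ g, IsOuterInverse f g ∧ 1 - g * f ∈ 𝓕 ∧ IdemSub (1 - g * f) (1 - f * g)}

/-- Elements with an outer inverse whose target defect is of finite type and subordinate to its
source defect. -/
def RightWeyl : Set A :=
  {f | ∃ g, IsOuterInverse f g ∧ 1 - f * g ∈ 𝓕 ∧ IdemSub (1 - f * g) (1 - g * f)}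

/-- Elements with an outer inverse whose defects are of finite type and equivalent. -/
def Weyl : Set A :=
  {f | ∃ g, IsOuterInverse f g ∧ 1 - g * f ∈ 𝓕 ∧ 1 - f * g ∈ 𝓕 ∧
    IdemEquiv (1 - g * f) (1 - f * g)}

variable {𝓕}

/-- The factor 2 is the norm loss of compression. -/
lemma exists_ball_radius (g : A) : ∃ ε > 0, ∀ d : A, ‖d‖ < ε → 2 * ‖g‖ * ‖d‖ < 1 := by
  have hg := norm_nonneg g
  refine ⟨1 / (2 * ‖g‖ + 1), by positivity, fun d hd => ?_⟩
  rw [lt_div_iff₀ (by positivity)] at hd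
  nlinarith [norm_nonneg d]

lemma isUnit_one_add_mul_self {g d : A} (hd : 2 * ‖g‖ * ‖d‖ < 1) : IsUnit (1 + g * d) :=
  isUnit_one_add_mul (by linarith [norm_nonneg g]) hd

lemma isOpen_leftFredholm_diff_leftWeyl (h𝓕 : IsFiniteTypeIdeal 𝓕) :
    IsOpen (LeftFredholm 𝓕 \ LeftWeyl 𝓕) := by
  rw [Metric.isOpen_iff]
  rintro f ⟨⟨g, hg, hgm⟩, hf⟩
  obtain ⟨ε, hε, H⟩ := exists_ball_radius g
  refine ⟨ε, hε, fun f' hf' => ?_⟩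
  obtain ⟨d, rfl⟩ : ∃ d, f' = f + d := ⟨f' - f, by abel⟩
  have hd := H d (by simpa [dist_eq_norm] using hf')
  obtain ⟨u, hu⟩ := isUnit_one_add_mul_self hd
  obtain ⟨hO, E, -⟩ := hg.perturb d u hu
  refine ⟨⟨_, hO, h𝓕.mem_of_idemEquiv E hgm⟩, ?_⟩
  rintro ⟨h, hh, hhm, hsub⟩
  obtain ⟨k, l, hk, hkm, hl, hlh, E₁, E₂⟩ := exists_common_refinement h𝓕 hg hgm hd hh hhm
  exact hf ⟨k, hk, hkm,
    E₁.idemSub.trans ((hh.idemSub_of_mul_eq hl hlh hsub).trans E₂.symm.idemSub)⟩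

lemma isOpen_fredholm_diff_weyl (h𝓕 : IsFiniteTypeIdeal 𝓕) :
    IsOpen (Fredholm 𝓕 \ Weyl 𝓕) := by
  rw [Metric.isOpen_iff]
  rintro f ⟨⟨g, hg, hgm, hgm'⟩, hf⟩
  obtain ⟨ε, hε, H⟩ := exists_ball_radius g
  refine ⟨ε, hε, fun f' hf' => ?_⟩
  obtain ⟨d, rfl⟩ : ∃ d, f' = f + d := ⟨f' - f, by abel⟩
  have hd := H d (by simpa [dist_eq_norm] using hf')
  obtain ⟨u, hu⟩ := isUnit_one_add_mul_self hd
  obtain ⟨hO, E, E'⟩ := hg.perturb d u hu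
  refine ⟨⟨_, hO, h𝓕.mem_of_idemEquiv E hgm, h𝓕.mem_of_idemEquiv E' hgm'⟩, ?_⟩
  rintro ⟨h, hh, hhm, -, hequiv⟩
  obtain ⟨k, l, hk, hkm, hl, hlh, E₁, E₂⟩ := exists_common_refinement h𝓕 hg hgm hd hh hhm
  have E₃ := E₁.trans ((hh.idemEquiv_of_mul_eq hl hlh hequiv).trans E₂.symm)
  -- Compression controls only the source defect; the target defect lies in `𝓕` because it is
  -- equivalent to it.
  exact hf ⟨k, hk, hkm, h𝓕.mem_of_idemEquiv E₃ hkm, E₃⟩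

lemma IsOuterInverse.star {f g : A} (h : IsOuterInverse f g) :
    IsOuterInverse (star f) (star g) := by
  unfold IsOuterInverse
  rw [← star_mul, ← star_mul, h.mul_assoc_eq]

lemma IdemSub.star {p q : A} (h : IdemSub p q) : IdemSub (star p) (star q) := by
  obtain ⟨s, t, rfl⟩ := h
  exact ⟨Star.star t, Star.star s, by simp [mul_assoc]⟩

/-- Adjoints carry outer inverses to outer inverses and exchange source and target defects. -/
lemma star_mem_leftFredholm {f : A} : star f ∈ LeftFredholm 𝓕 ↔ f ∈ RightFredholm 𝓕 := by
  constructor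
  · rintro ⟨g, hg, hm⟩
    exact ⟨star g, by simpa using hg.star, by simpa using star_mem hm⟩
  · rintro ⟨g, hg, hm⟩
    exact ⟨star g, hg.star, by simpa using star_mem hm⟩

lemma star_mem_leftWeyl {f : A} : star f ∈ LeftWeyl 𝓕 ↔ f ∈ RightWeyl 𝓕 := by
  constructor
  · rintro ⟨g, hg, hm, hs⟩
    exact ⟨star g, by simpa using hg.star, by simpa using star_mem hm, by simpa using hs.star⟩
  · rintro ⟨g, hg, hm, hs⟩
    exact ⟨star g, hg.star, by simpa using star_mem hm, by simpa using hs.star⟩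

lemma isOpen_rightFredholm_diff_rightWeyl (h𝓕 : IsFiniteTypeIdeal 𝓕) :
    IsOpen (RightFredholm 𝓕 \ RightWeyl 𝓕) := by
  have : RightFredholm 𝓕 \ RightWeyl 𝓕 = star ⁻¹' (LeftFredholm 𝓕 \ LeftWeyl 𝓕) := by
    ext f
    simp [star_mem_leftFredholm, star_mem_leftWeyl]
  rw [this]
  exact (isOpen_leftFredholm_diff_leftWeyl h𝓕).preimage continuous_star

/-! ### Invertibility, range projections and left inverses -/

lemma isUnit_algebraMap_sub_of_im_ne_zero {b : A} (hb : IsSelfAdjoint b) {z : ℂ}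
    (hz : z.im ≠ 0) : IsUnit (algebraMap ℂ A z - b) := by
  by_contra h
  exact hz (hb.im_eq_zero_of_mem_spectrum (spectrum.mem_iff.2 h))

/-- A selfadjoint element that is bounded below is invertible. -/
lemma isUnit_of_isSelfAdjoint_of_bound {b : A} (hb : IsSelfAdjoint b) {c : ℝ} (hc : 0 < c)
    (h : ∀ x, c * ‖x‖ ≤ ‖b * x‖) : IsUnit b := by
  -- The spectrum is real, so `z - b` is invertible; the lower bound on `b` gives its inverse norm
  -- at most `3 / (2c)`. As `‖z‖ = c / 3`, a Neumann series removes the shift.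
  set z : ℂ := ((c / 3 : ℝ) : ℂ) * Complex.I with hz
  have hzn : ‖z‖ = c / 3 := by
    rw [hz, norm_mul, Complex.norm_I, mul_one, Complex.norm_real,
      Real.norm_of_nonneg (by positivity)]
  obtain ⟨y, hy⟩ := isUnit_algebraMap_sub_of_im_ne_zero hb (z := z) (by simp [hz, hc.ne'])
  have hy' : (y : A) = z • 1 - b := by rw [hy, Algebra.algebraMap_eq_smul_one]
  set v : A := ↑y⁻¹ with hv
  have hyv : (y : A) * v = 1 := Units.mul_inv y
  have hbv : b * v = z • v - 1 := by
    rw [← hyv, hy', sub_mul, smul_mul_assoc, one_mul]; abel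
  have h1 : ‖(1 : A)‖ ≤ 1 := (IsStarProjection.one (R := A)).norm_le
  have hvn : c * ‖v‖ ≤ c / 3 * ‖v‖ + 1 := by
    calc c * ‖v‖ ≤ ‖z • v - 1‖ := by rw [← hbv]; exact h v
      _ ≤ ‖z • v‖ + ‖(1 : A)‖ := norm_sub_le _ _
      _ ≤ c / 3 * ‖v‖ + 1 := by rw [norm_smul, hzn]; gcongr
  have hlt : ‖z • v‖ < 1 := by rw [norm_smul, hzn]; linarith
  have hfac : -b = y * (1 - z • v) := by
    rw [mul_sub, mul_smul_comm, hyv, mul_one, hy']; abel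
  rw [← IsUnit.neg_iff, hfac]
  exact y.isUnit.mul (Units.oneSub _ hlt).isUnit

/-- With the selfadjoint `a = i(n - n*)`, the element is `1 + a² = (i - a)(-i - a)`. -/
lemma isUnit_one_sub_sq (n : A) : IsUnit (1 - (n - star n) * (n - star n)) := by
  have ha : IsSelfAdjoint (Complex.I • (n - star n)) := by
    rw [isSelfAdjoint_iff, star_smul, star_sub, star_star]
    simp only [smul_sub, RCLike.star_def, Complex.conj_I, neg_smul]; abel
  have h₁ := isUnit_algebraMap_sub_of_im_ne_zero ha (z := Complex.I) (by simp)
  have h₂ := isUnit_algebraMap_sub_of_im_ne_zero ha (z := -Complex.I) (by simp)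
  convert h₁.mul h₂ using 1
  simp only [Algebra.algebraMap_eq_smul_one, ← smul_sub, neg_smul, smul_mul_assoc]
  rw [← smul_neg, ← smul_sub, mul_smul_comm, smul_smul, Complex.I_mul_I]
  rw [neg_smul, one_smul]
  noncomm_ring

/-- The range projection of an idempotent. -/
lemma exists_range_projection {n : A} (hn : IsIdempotentElem n) :
    ∃ p : A, IsStarProjection p ∧ p * n = n ∧ n * p = p := by
  have hnn : n * n = n := hn
  have hss : star n * star n = star n := by rw [← star_mul, hnn]
  -- `z` commutes with `n` and `n*`, and `n z = n n* n`; hence `n n* z⁻¹` is the projection.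
  obtain ⟨z, hz⟩ := isUnit_one_sub_sq n
  have hz' : (z : A) = 1 - (n - n * star n - star n * n + star n) := by
    rw [hz, sub_mul, mul_sub, mul_sub, hnn, hss]; abel
  have hnz : n * z = n * star n * n := by
    rw [hz']; simp only [mul_sub, mul_add, ← mul_assoc, hnn]; noncomm_ring
  have hzn : z * n = n * star n * n := by
    rw [hz']; simp only [sub_mul, add_mul, mul_assoc, hnn]; noncomm_ring
  have hsz : star (z : A) = z := by
    rw [hz']; simp only [star_sub, star_add, star_mul, star_star, star_one]; abel
  have hcn : Commute (z : A) n := by rw [Commute, SemiconjBy, hnz, hzn]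
  have hcs : Commute (z : A) (star n) := by
    have := hcn.star_star
    rwa [hsz] at this
  have hsi : star (↑z⁻¹ : A) = ↑z⁻¹ := by
    have h : star (↑z⁻¹ : A) * z = 1 := by
      rw [← hsz, ← star_mul, Units.mul_inv, star_one]
    exact Units.eq_inv_of_mul_eq_one_right h
  have hci : Commute (↑z⁻¹ : A) (n * star n) := (hcn.mul_right hcs).units_inv_left
  have hci' : Commute (↑z⁻¹ : A) n := hcn.units_inv_left
  have hpn : n * star n * ↑z⁻¹ * n = n := by
    rw [mul_assoc, hci'.eq, ← mul_assoc, ← hnz, mul_assoc, Units.mul_inv, mul_one]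
  refine ⟨n * star n * ↑z⁻¹, ⟨?_, ?_⟩, hpn, ?_⟩
  · show _ * _ = _
    rw [← mul_assoc, ← mul_assoc, hpn]
  · rw [isSelfAdjoint_iff, star_mul, hsi, star_mul, star_star, hci.eq]
  · rw [← mul_assoc, ← mul_assoc, hnn]

/-- If left multiplication by `t` is bounded below on the range of the idempotent `n`, then `t` is
left invertible there. -/
lemma exists_left_inverse_of_bound {n t : A} (hn : IsIdempotentElem n) (ht : t * n = t) {C : ℝ}
    (hC : 0 < C) (h : ∀ x, n * x = x → ‖x‖ ≤ C * ‖t * x‖) : ∃ s, s * t = n := by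
  obtain ⟨p, hp, hpn, hnp⟩ := exists_range_projection hn
  have hpp : p * p = p := hp.isIdempotentElem
  have hps : star p = p := hp.isSelfAdjoint
  have hp1 : ‖p‖ ≤ 1 := hp.norm_le
  have hq1 : ‖1 - p‖ ≤ 1 := hp.one_sub.norm_le
  -- Adding `1 - p` makes `t* t`, compressed to the range of `n`, bounded below on all of `A`; then
  -- `b⁻¹ p t*` is the left inverse.
  set b := p * star t * t * p + (1 - p) with hb
  have hbs : IsSelfAdjoint b := by
    rw [isSelfAdjoint_iff, hb]
    simp [hps, mul_assoc]
  have hpb : p * b = p * star t * t * p := by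
    rw [hb, mul_add, mul_sub, hpp]; simp [← mul_assoc, hpp]
  have hqb : (1 - p) * b = 1 - p := by
    rw [sub_mul, hpb, hb]; simp
  have hbp : b * p = p * star t * t * p := by
    rw [hb, add_mul, sub_mul, hpp]; simp [mul_assoc, hpp]
  have bound (x : A) : ‖x‖ ≤ (C ^ 2 + 1) * ‖b * x‖ := by
    have h₁ : ‖(1 - p) * x‖ ≤ ‖b * x‖ := by
      calc ‖(1 - p) * x‖ = ‖(1 - p) * (b * x)‖ := by rw [← mul_assoc, hqb]
        _ ≤ ‖1 - p‖ * ‖b * x‖ := norm_mul_le _ _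
        _ ≤ 1 * ‖b * x‖ := by gcongr
        _ = ‖b * x‖ := one_mul _
    have h₂ : ‖p * (b * x)‖ ≤ ‖b * x‖ := by
      calc _ ≤ ‖p‖ * ‖b * x‖ := norm_mul_le _ _
        _ ≤ 1 * ‖b * x‖ := by gcongr
        _ = ‖b * x‖ := one_mul _
    have h₃ : ‖t * (p * x)‖ * ‖t * (p * x)‖ ≤ ‖p * x‖ * ‖b * x‖ := by
      calc ‖t * (p * x)‖ * ‖t * (p * x)‖ = ‖star (t * (p * x)) * (t * (p * x))‖ :=
            CStarRing.norm_star_mul_self.symm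
        _ = ‖star (p * x) * (p * (b * x))‖ := by
            rw [← mul_assoc p b x, hpb]
            simp only [star_mul, hps, mul_assoc]
            rw [← mul_assoc p p, hpp]
        _ ≤ ‖p * x‖ * ‖b * x‖ := by
            refine (norm_mul_le _ _).trans ?_
            rw [norm_star]; gcongr
    have h₄ := h (p * x) (by rw [← mul_assoc, hnp])
    have h₅ : ‖p * x‖ ≤ C ^ 2 * ‖b * x‖ := by
      rcases (norm_nonneg (p * x)).eq_or_lt with h0 | h0
      · rw [← h0]; positivity
      · refine le_of_mul_le_mul_left ?_ h0
        calc ‖p * x‖ * ‖p * x‖ ≤ (C * ‖t * (p * x)‖) * (C * ‖t * (p * x)‖) := by gcongr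
          _ = C ^ 2 * (‖t * (p * x)‖ * ‖t * (p * x)‖) := by ring
          _ ≤ C ^ 2 * (‖p * x‖ * ‖b * x‖) := by gcongr
          _ = _ := by ring
    calc ‖x‖ = ‖p * x + (1 - p) * x‖ := by congr 1; noncomm_ring
      _ ≤ _ := norm_add_le _ _
      _ ≤ _ := by linarith
  obtain ⟨w, hw⟩ := isUnit_of_isSelfAdjoint_of_bound hbs (c := (C ^ 2 + 1)⁻¹) (by positivity)
    fun x => by rw [inv_mul_le_iff₀ (by positivity)]; exact bound x
  refine ⟨↑w⁻¹ * (p * star t), ?_⟩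
  rw [mul_assoc, Units.inv_mul_eq_iff_eq_mul, hw]
  calc p * star t * t = p * star t * t * p * n := by
        rw [mul_assoc, mul_assoc, mul_assoc, mul_assoc, hpn, ht, ← mul_assoc]
    _ = b * n := by rw [← hbp, mul_assoc, hpn]

end Analysis


/-! ### Translation between submodules of `A` and idempotents -/

section Bridge

variable {A : Type*} [CStarAlgebra A]

lemma leftMul_apply (a x : A) : leftMul a x = a * x := rfl

lemma EndMod.apply_eq (F : EndMod A) (x : A) : F x = F 1 * x := by
  have := F.map_smul (op x) 1
  simpa using this

/-- The right ideal `a * A`, as a submodule. -/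
def rangeMul (a : A) : Submodule Aᵐᵒᵖ A where
  carrier := {x | ∃ y, a * y = x}
  add_mem' := by
    rintro _ _ ⟨y, rfl⟩ ⟨z, rfl⟩
    exact ⟨y + z, mul_add _ _ _⟩
  zero_mem' := ⟨0, mul_zero _⟩
  smul_mem' := by
    rintro c _ ⟨y, rfl⟩
    exact ⟨y * unop c, by simp [MulOpposite.smul_eq_mul_unop, mul_assoc]⟩

lemma mul_mem_rangeMul (a x : A) : a * x ∈ rangeMul a := ⟨x, rfl⟩

lemma self_mem_rangeMul (a : A) : a ∈ rangeMul a := ⟨1, mul_one a⟩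

lemma mem_rangeMul_iff {a : A} (ha : IsIdempotentElem a) {x : A} :
    x ∈ rangeMul a ↔ a * x = x := by
  constructor
  · rintro ⟨y, rfl⟩
    rw [← mul_assoc, ha]
  · intro h
    exact ⟨x, h⟩

lemma isClosed_rangeMul {a : A} (ha : IsIdempotentElem a) :
    IsClosed (rangeMul a : Set A) := by
  have : (rangeMul a : Set A) = {x | a * x = x} := by
    ext x; exact mem_rangeMul_iff ha
  rw [this]
  exact isClosed_eq (by fun_prop) continuous_id

lemma mul_mem_of_mem {M : Submodule Aᵐᵒᵖ A} {x : A} (hx : x ∈ M) (y : A) : x * y ∈ M := by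
  simpa using M.smul_mem (op y) hx

lemma isDirectSum_rangeMul {a : A} (ha : IsIdempotentElem a) :
    IsDirectSum (rangeMul a) (rangeMul (1 - a)) := by
  refine ⟨isClosed_rangeMul ha, isClosed_rangeMul ha.one_sub, ?_⟩
  rw [isCompl_iff]
  constructor
  · rw [Submodule.disjoint_def]
    intro x hx hx'
    rw [mem_rangeMul_iff ha] at hx
    rw [mem_rangeMul_iff ha.one_sub, sub_mul, hx] at hx'
    simpa using hx'.symm
  · rw [codisjoint_iff, Submodule.eq_top_iff']
    intro x
    rw [Submodule.mem_sup]
    exact ⟨a * x, mul_mem_rangeMul _ _, (1 - a) * x, mul_mem_rangeMul _ _, by noncomm_ring⟩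

/-- Every direct sum decomposition of `A` into submodules comes from an idempotent. -/
lemma exists_idempotent_of_isCompl {M N : Submodule Aᵐᵒᵖ A} (h : IsCompl M N) :
    ∃ a : A, IsIdempotentElem a ∧ M = rangeMul a ∧ N = rangeMul (1 - a) := by
  have htop : (1 : A) ∈ M ⊔ N := by rw [h.sup_eq_top]; trivial
  -- The `M`-component of the unit is the required idempotent.
  obtain ⟨m, hm, n, hn, hmn⟩ := Submodule.mem_sup.1 htop
  have hdis := Submodule.disjoint_def.1 h.disjoint
  have hn' : n = 1 - m := by rw [← hmn]; abel
  have hM (x : A) (hx : x ∈ M) : n * x = 0 := by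
    refine hdis _ ?_ (mul_mem_of_mem hn x)
    rw [hn', sub_mul, one_mul]
    exact M.sub_mem hx (mul_mem_of_mem hm x)
  have hN (x : A) (hx : x ∈ N) : m * x = 0 := by
    refine hdis _ (mul_mem_of_mem hm x) ?_
    have : m = 1 - n := by rw [← hmn]; abel
    rw [this, sub_mul, one_mul]
    exact N.sub_mem hx (mul_mem_of_mem hn x)
  have hidem : IsIdempotentElem m := by
    have := hM m hm
    rw [hn', sub_mul, one_mul, sub_eq_zero] at this
    exact this.symm
  refine ⟨m, hidem, ?_, ?_⟩
  · ext x
    rw [mem_rangeMul_iff hidem]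
    constructor
    · intro hx
      have := hM x hx
      rw [hn', sub_mul, one_mul, sub_eq_zero] at this
      exact this.symm
    · intro hx
      rw [← hx]
      exact mul_mem_of_mem hm x
  · ext x
    rw [mem_rangeMul_iff hidem.one_sub, ← hn']
    constructor
    · intro hx
      rw [hn', sub_mul, hN x hx]; simp
    · intro hx
      rw [← hx]
      exact mul_mem_of_mem hn x

/-- A module map out of `a * A` is left multiplication by the image of `a`. -/
lemma coe_apply_eq_mul {a : A} (ha : IsIdempotentElem a) {N : Submodule Aᵐᵒᵖ A}
    (e : rangeMul a →L[Aᵐᵒᵖ] N) (x : rangeMul a) :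
    (e x : A) = e ⟨a, self_mem_rangeMul a⟩ * x := by
  have hx : x = op (x : A) • (⟨a, self_mem_rangeMul a⟩ : rangeMul a) := by
    ext
    simpa using ((mem_rangeMul_iff ha).1 x.2).symm
  conv_lhs => rw [hx, map_smul]
  simp

/-- Equivalent idempotents have isomorphic ranges. -/
noncomputable def rangeMulEquiv {n m s t : A} (hn : IsIdempotentElem n) (hm : IsIdempotentElem m)
    (hst : s * t = n) (hts : t * s = m) (hs : n * s = s) (ht : m * t = t) :
    rangeMul n ≃L[Aᵐᵒᵖ] rangeMul m where
  toFun x := ⟨t * x, (mem_rangeMul_iff hm).2 (by rw [← mul_assoc, ht])⟩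
  invFun x := ⟨s * x, (mem_rangeMul_iff hn).2 (by rw [← mul_assoc, hs])⟩
  map_add' x y := by ext; simp [mul_add]
  map_smul' c x := by ext; simp [MulOpposite.smul_eq_mul_unop, mul_assoc]
  left_inv x := by
    ext
    simpa [← mul_assoc, hst] using (mem_rangeMul_iff hn).1 x.2
  right_inv x := by
    ext
    simpa [← mul_assoc, hts] using (mem_rangeMul_iff hm).1 x.2
  continuous_toFun := by
    exact (continuous_const.mul continuous_subtype_val).subtype_mk _
  continuous_invFun := by
    exact (continuous_const.mul continuous_subtype_val).subtype_mk _

/-- An isomorphism and its inverse are left multiplications by the images of the generators `n` and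
`m`; these images are the witnesses. -/
lemma modIso_rangeMul_iff {n m : A} (hn : IsIdempotentElem n) (hm : IsIdempotentElem m) :
    ModIso (rangeMul n) (rangeMul m) ↔ IdemEquiv n m := by
  constructor
  · rintro ⟨e⟩
    have h₁ := coe_apply_eq_mul hn (e : rangeMul n →L[Aᵐᵒᵖ] rangeMul m)
    have h₂ := coe_apply_eq_mul hm (e.symm : rangeMul m →L[Aᵐᵒᵖ] rangeMul n)
    simp only [ContinuousLinearEquiv.coe_coe] at h₁ h₂
    refine ⟨_, _, ?_, ?_, (mem_rangeMul_iff hn).1 (e.symm ⟨m, self_mem_rangeMul m⟩).2,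
      (mem_rangeMul_iff hm).1 (e ⟨n, self_mem_rangeMul n⟩).2⟩
    · rw [← h₂]; simp
    · rw [← h₁]; simp
  · rintro ⟨s, t, hst, hts, hs, ht⟩
    exact ⟨rangeMulEquiv hn hm hst hts hs ht⟩

/-- A continuous module map between submodules of `A` is bounded. -/
lemma exists_bound {M N : Submodule Aᵐᵒᵖ A} (e : M →L[Aᵐᵒᵖ] N) :
    ∃ C > 0, ∀ x : M, ‖(e x : A)‖ ≤ C * ‖(x : A)‖ := by
  let e' : M →L[ℂ] N := e.restrictScalars ℂ
  obtain ⟨C, hC, h⟩ := e'.bound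
  exact ⟨C, hC, h⟩

/-- `N'` is not assumed complemented, so a left inverse of the embedding must come from its lower
bound. Conversely, `s` and `t` cut down by `n` and `m` yield an idempotent whose range is the
submodule. -/
lemma modSub_rangeMul_iff {n m : A} (hn : IsIdempotentElem n) (hm : IsIdempotentElem m) :
    ModSub (rangeMul n) (rangeMul m) ↔ IdemSub n m := by
  constructor
  · rintro ⟨N', hN', -, ⟨e⟩⟩
    have h₁ := coe_apply_eq_mul hn (e : rangeMul n →L[Aᵐᵒᵖ] N')
    simp only [ContinuousLinearEquiv.coe_coe] at h₁
    set t : A := Subtype.val (e ⟨n, self_mem_rangeMul n⟩)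
    have hmt : m * t = t := (mem_rangeMul_iff hm).1 (hN' (e ⟨n, self_mem_rangeMul n⟩).2)
    have htn : t * n = t := (h₁ ⟨n, self_mem_rangeMul n⟩).symm
    obtain ⟨C, hC, h⟩ := exists_bound (e.symm : N' →L[Aᵐᵒᵖ] rangeMul n)
    obtain ⟨s, hs⟩ := exists_left_inverse_of_bound hn htn hC fun x hx => by
      have := h (e ⟨x, (mem_rangeMul_iff hn).2 hx⟩)
      rw [h₁] at this
      simpa using this
    exact ⟨s, t, by rw [mul_assoc, hmt, hs]⟩
  · rintro ⟨s, t, hst⟩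
    have hnn : n * n = n := hn
    have hmm : m * m = m := hm
    have e₁ : n * s * m * (m * t * n) = n := by
      calc n * s * m * (m * t * n) = n * (s * (m * m) * t) * n := by noncomm_ring
        _ = n := by rw [hmm, hst, hnn, hnn]
    set s' := n * s * m with hs'
    set t' := m * t * n with ht'
    have hns : n * s' = s' := by rw [hs', ← mul_assoc, ← mul_assoc, hnn]
    have htn : t' * n = t' := by rw [ht', mul_assoc, hnn]
    have hmt : m * t' = t' := by rw [ht', ← mul_assoc, ← mul_assoc, hmm]
    have hidem : IsIdempotentElem (t' * s') := by
      show _ * _ = _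
      rw [mul_assoc, ← mul_assoc s', e₁, hns]
    refine ⟨rangeMul (t' * s'), ?_, isClosed_rangeMul hidem,
      (modIso_rangeMul_iff hn hidem).2 ⟨s', t', e₁, rfl, hns, by rw [mul_assoc, e₁, htn]⟩⟩
    rintro _ ⟨y, rfl⟩
    rw [mem_rangeMul_iff hm, ← mul_assoc, ← mul_assoc, hmt]

/-- An idempotent and its range projection are multiples of each other, so an ideal contains both or
neither. -/
lemma projMem_rangeMul_iff {𝓕 : NonUnitalStarSubalgebra ℂ A} (h𝓕 : IsFiniteTypeIdeal 𝓕) {n : A}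
    (hn : IsIdempotentElem n) : ProjMem 𝓕 (rangeMul n) ↔ n ∈ 𝓕 := by
  constructor
  · rintro ⟨p, hp, h⟩
    have hmem : n ∈ Set.range (leftMul p) := by
      rw [h.range_eq]; exact self_mem_rangeMul n
    obtain ⟨y, hy⟩ := hmem
    rw [leftMul_apply] at hy
    rw [← hy]
    exact h𝓕.mul_mem_right _ _ hp
  · intro hmem
    obtain ⟨p, hp, hpn, hnp⟩ := exists_range_projection hn
    have hps : star p = p := hp.isSelfAdjoint
    refine ⟨p, hnp ▸ h𝓕.mul_mem_right _ _ hmem, ⟨fun x => ?_, fun x y => ?_, ?_⟩⟩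
    · rw [leftMul_apply, leftMul_apply, ← mul_assoc, hp.isIdempotentElem]
    · rw [leftMul_apply, leftMul_apply, star_mul, hps, mul_assoc]
    · ext x
      constructor
      · rintro ⟨y, rfl⟩
        exact (mem_rangeMul_iff hn).2 (by rw [leftMul_apply, ← mul_assoc, hnp])
      · rintro ⟨y, rfl⟩
        exact ⟨n * y, by rw [leftMul_apply, ← mul_assoc, hpn]⟩

/-- An outer inverse yields a decomposition. -/
lemma IsOuterInverse.isDecomposition {F : EndMod A} {g : A} (h : IsOuterInverse (F 1) g) :
    IsDecomposition F (rangeMul (g * F 1)) (rangeMul (1 - g * F 1))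
      (rangeMul (F 1 * g)) (rangeMul (1 - F 1 * g)) := by
  have h' := h.mul_assoc_eq
  have hl := h.isIdempotentElem_left
  have hr := h.isIdempotentElem_right
  refine ⟨isDirectSum_rangeMul hl, isDirectSum_rangeMul hr, ?_, ?_⟩
  · refine ⟨rangeMulEquiv (s := g) (t := F 1 * g * F 1) hl hr ?_ ?_ h ?_, fun x => ?_⟩
    · rw [← mul_assoc, h']
    · rw [mul_assoc, hr]
    · rw [← mul_assoc, hr]
    · change F 1 * g * F 1 * x = F x
      rw [F.apply_eq x, mul_assoc, mul_assoc, ← mul_assoc g, (mem_rangeMul_iff hl).1 x.2]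
  · intro x hx
    rw [mem_rangeMul_iff hl.one_sub] at hx
    rw [mem_rangeMul_iff hr.one_sub, F.apply_eq x]
    calc (1 - F 1 * g) * (F 1 * x) = F 1 * ((1 - g * F 1) * x) := by noncomm_ring
      _ = F 1 * x := by rw [hx]

/-- Every decomposition comes from an outer inverse. -/
lemma IsDecomposition.exists_isOuterInverse {F : EndMod A} {M₁ N₁ M₂ N₂ : Submodule Aᵐᵒᵖ A}
    (h : IsDecomposition F M₁ N₁ M₂ N₂) :
    ∃ g, IsOuterInverse (F 1) g ∧ N₁ = rangeMul (1 - g * F 1) ∧ N₂ = rangeMul (1 - F 1 * g) := by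
  obtain ⟨a, ha, rfl, rfl⟩ := exists_idempotent_of_isCompl h.source.isCompl
  obtain ⟨b, hb, rfl, rfl⟩ := exists_idempotent_of_isCompl h.target.isCompl
  obtain ⟨e, he⟩ := h.iso
  have h₂ := coe_apply_eq_mul hb (e.symm : rangeMul b →L[Aᵐᵒᵖ] rangeMul a)
  simp only [ContinuousLinearEquiv.coe_coe] at h₂
  -- `g` is the inverse of the isomorphism, extended by zero on `N₂`.
  set g : A := Subtype.val (e.symm ⟨b, self_mem_rangeMul b⟩) with hg
  have hag : a * g = g := (mem_rangeMul_iff ha).1 (e.symm ⟨b, self_mem_rangeMul b⟩).2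
  have hgb : g * b = g := (h₂ ⟨b, self_mem_rangeMul b⟩).symm
  have hfg : F 1 * g = b := by
    rw [← F.apply_eq, hg, ← he]; simp
  have hgfa : g * (F 1 * a) = a := by
    have := h₂ (e ⟨a, self_mem_rangeMul a⟩)
    rw [he, F.apply_eq] at this
    simpa using this.symm
  have hgfn : g * (F 1 * (1 - a)) = 0 := by
    have := h.mapsTo _ (self_mem_rangeMul (1 - a))
    rw [mem_rangeMul_iff hb.one_sub, F.apply_eq, sub_mul, one_mul, sub_eq_self] at this
    rw [← hgb, mul_assoc, this, mul_zero]
  have hgf : g * F 1 = a := by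
    calc g * F 1 = g * (F 1 * a) + g * (F 1 * (1 - a)) := by noncomm_ring
      _ = a := by rw [hgfa, hgfn, add_zero]
  exact ⟨g, by rw [IsOuterInverse, hgf, hag], by rw [hgf], by rw [hfg]⟩

lemma mem_iff_of_decomposition {P : Submodule Aᵐᵒᵖ A → Submodule Aᵐᵒᵖ A → Prop}
    {Q : A → A → Prop} (F : EndMod A)
    (hPQ : ∀ n m : A, IsIdempotentElem n → IsIdempotentElem m →
      (P (rangeMul n) (rangeMul m) ↔ Q n m)) :
    (∃ M₁ N₁ M₂ N₂, IsDecomposition F M₁ N₁ M₂ N₂ ∧ P N₁ N₂) ↔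
      ∃ g, IsOuterInverse (F 1) g ∧ Q (1 - g * F 1) (1 - F 1 * g) := by
  constructor
  · rintro ⟨M₁, N₁, M₂, N₂, h, hP⟩
    obtain ⟨g, hg, rfl, rfl⟩ := h.exists_isOuterInverse
    exact ⟨g, hg, (hPQ _ _ hg.isIdempotentElem_left.one_sub
      hg.isIdempotentElem_right.one_sub).1 hP⟩
  · rintro ⟨g, hg, hQ⟩
    exact ⟨_, _, _, _, hg.isDecomposition, (hPQ _ _ hg.isIdempotentElem_left.one_sub
      hg.isIdempotentElem_right.one_sub).2 hQ⟩

variable {𝓕 : NonUnitalStarSubalgebra ℂ A}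

lemma mem_mkPhiPlus_iff (h𝓕 : IsFiniteTypeIdeal 𝓕) (F : EndMod A) :
    F ∈ MKPhiPlus 𝓕 ↔ F 1 ∈ LeftFredholm 𝓕 :=
  mem_iff_of_decomposition (P := fun N₁ _ => ProjMem 𝓕 N₁) (Q := fun n _ => n ∈ 𝓕) F
    fun _ _ hn _ => projMem_rangeMul_iff h𝓕 hn

lemma mem_mkPhiMinus_iff (h𝓕 : IsFiniteTypeIdeal 𝓕) (F : EndMod A) :
    F ∈ MKPhiMinus 𝓕 ↔ F 1 ∈ RightFredholm 𝓕 :=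
  mem_iff_of_decomposition (P := fun _ N₂ => ProjMem 𝓕 N₂) (Q := fun _ m => m ∈ 𝓕) F
    fun _ _ _ hm => projMem_rangeMul_iff h𝓕 hm

lemma mem_mkPhi_iff (h𝓕 : IsFiniteTypeIdeal 𝓕) (F : EndMod A) :
    F ∈ MKPhi 𝓕 ↔ F 1 ∈ Fredholm 𝓕 :=
  mem_iff_of_decomposition (P := fun N₁ N₂ => ProjMem 𝓕 N₁ ∧ ProjMem 𝓕 N₂)
    (Q := fun n m => n ∈ 𝓕 ∧ m ∈ 𝓕) F
    fun _ _ hn hm => and_congr (projMem_rangeMul_iff h𝓕 hn) (projMem_rangeMul_iff h𝓕 hm)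

lemma mem_mkPhiPlusMinus_iff (h𝓕 : IsFiniteTypeIdeal 𝓕) (F : EndMod A) :
    F ∈ MKPhiPlusMinus 𝓕 ↔ F 1 ∈ LeftWeyl 𝓕 :=
  mem_iff_of_decomposition (P := fun N₁ N₂ => ProjMem 𝓕 N₁ ∧ ModSub N₁ N₂)
    (Q := fun n m => n ∈ 𝓕 ∧ IdemSub n m) F
    fun _ _ hn hm => and_congr (projMem_rangeMul_iff h𝓕 hn) (modSub_rangeMul_iff hn hm)

lemma mem_mkPhiMinusPlus_iff (h𝓕 : IsFiniteTypeIdeal 𝓕) (F : EndMod A) :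
    F ∈ MKPhiMinusPlus 𝓕 ↔ F 1 ∈ RightWeyl 𝓕 :=
  mem_iff_of_decomposition (P := fun N₁ N₂ => ProjMem 𝓕 N₂ ∧ ModSub N₂ N₁)
    (Q := fun n m => m ∈ 𝓕 ∧ IdemSub m n) F
    fun _ _ hn hm => and_congr (projMem_rangeMul_iff h𝓕 hm) (modSub_rangeMul_iff hm hn)

lemma mem_mkPhiZero_iff (h𝓕 : IsFiniteTypeIdeal 𝓕) (F : EndMod A) :
    F ∈ MKPhiZero 𝓕 ↔ F 1 ∈ Weyl 𝓕 :=
  mem_iff_of_decomposition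
    (P := fun N₁ N₂ => ProjMem 𝓕 N₁ ∧ ProjMem 𝓕 N₂ ∧ ModIso N₁ N₂)
    (Q := fun n m => n ∈ 𝓕 ∧ m ∈ 𝓕 ∧ IdemEquiv n m) F
    fun _ _ hn hm => and_congr (projMem_rangeMul_iff h𝓕 hn)
      (and_congr (projMem_rangeMul_iff h𝓕 hm) (modIso_rangeMul_iff hn hm))

/-- Evaluation at `1` is continuous for the operator-norm topology. -/
lemma isOpen_preimage_apply_one {S : Set A} (hS : IsOpen S) :
    IsOpen[normTopology A] {F : EndMod A | F 1 ∈ S} :=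
  ⟨{T : A →L[ℂ] A | T 1 ∈ S},
    hS.preimage (ContinuousLinearMap.apply ℂ A (1 : A)).continuous, rfl⟩

end Bridge

end FiniteType

theorem mainTheorem1 {A : Type*} [CStarAlgebra A] (𝓕 : NonUnitalStarSubalgebra ℂ A)
    (h𝓕 : FiniteType.IsFiniteTypeIdeal 𝓕) :
    IsOpen[FiniteType.normTopology A]
        (FiniteType.MKPhiPlus 𝓕 \ FiniteType.MKPhiPlusMinus 𝓕) ∧
      IsOpen[FiniteType.normTopology A]
        (FiniteType.MKPhiMinus 𝓕 \ FiniteType.MKPhiMinusPlus 𝓕) ∧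
      IsOpen[FiniteType.normTopology A]
        (FiniteType.MKPhi 𝓕 \ FiniteType.MKPhiZero 𝓕) := by
  refine ⟨?_, ?_, ?_⟩
  · convert FiniteType.isOpen_preimage_apply_one
      (FiniteType.isOpen_leftFredholm_diff_leftWeyl h𝓕) using 1
    ext F
    exact and_congr (FiniteType.mem_mkPhiPlus_iff h𝓕 F)
      (not_congr (FiniteType.mem_mkPhiPlusMinus_iff h𝓕 F))
  · convert FiniteType.isOpen_preimage_apply_one
      (FiniteType.isOpen_rightFredholm_diff_rightWeyl h𝓕) using 1
    ext F
    exact and_congr (FiniteType.mem_mkPhiMinus_iff h𝓕 F)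
      (not_congr (FiniteType.mem_mkPhiMinusPlus_iff h𝓕 F))
  · convert FiniteType.isOpen_preimage_apply_one
      (FiniteType.isOpen_fredholm_diff_weyl h𝓕) using 1
    ext F
    exact and_congr (FiniteType.mem_mkPhi_iff h𝓕 F)
      (not_congr (FiniteType.mem_mkPhiZero_iff h𝓕 F))
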